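/- For $n\ge 0$ let $$\hat G_n(x,z)=\sum_{k=0}^{\lfloor n/2\rfloor}(-1)^k\,\frac{\prod_{i=n-\lfloor n/2\rfloor}^{n-k-1}(z+i)\ \prod_{i=\lfloor n/2\rfloor}^{n-1}\left(z+\tfrac12+i\right)}{k!\,(n-2k)!}\;x^{n-2k}\,2^{-2k}$$ be the modified Gegenbauer polynomial, i.e. the Jacobi polynomial $P_n^{(z-1/2,\,z-1/2)}(x)$, or equivalently the rescaling $\hat G_n(x,z)=\frac{\prod_{i=0}^{n-1}(z+1/2+i)}{2^n\prod_{i=0}^{n-1}(z+i/2)}\,G_n^{(z)}(x)$ of the Gegenbauer polynomial $G_n^{(z)}(x)=\sum_{k=0}^{\lfloor n/2\rfloor}(-1)^k\frac{\prod_{i=0}^{n-k-1}(z+i)}{k!\,(n-2k)!}(2x)^{n-2k}$. Call a real number $z$ a constant root of $\hat G_n$ if $\hat G_n(x,z)=0$ for every real $x$. For $x\in[-1,1]$, the nonconstant roots of $\hat G_n(x,\cdot)$ are its real roots that are not constant roots. Then for every $n\ge 0$: 1. For every $x_0\in[-1,1]$ with $x_0\neq 0$, the polynomial $z\mapsto\hat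 G_n(x_0,z)$ has degree exactly $n$, all its roots are real, and all its roots are simple. 2. If $n$ is even, then $z\mapsto\hat G_n(0,z)$ is a nonzero polynomial, all its roots are real, and all its roots are simple. 3. There are $\lfloor n/2\rfloor$ real functions $\gamma_1,\dots,\gamma_{\lfloor n/2\rfloor}$ on $[-1,0)\cup(0,1]$ such that for every $x$ in this set $\gamma_1(x)>\gamma_2(x)>\dots>\gamma_{\lfloor n/2\rfloor}(x)$ and $\{\gamma_1(x),\dots,\gamma_{\lfloor n/2\rfloor}(x)\}$ is exactly the set of nonconstant roots of $\hat G_n(x,\cdot)$. Each $\gamma_i$ is strictly increasing on $[-1,0)$ and strictly decreasing on $(0,1]$, and $\gamma_i(x)\to+\infty$ as $x\to 0$ (from either side). -/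

import Mathlib

open Polynomial

/-- The Gegenbauer polynomial of degree `n`, evaluated at the real point `x` and regarded as a
polynomial in its parameter `z` (the indeterminate):
`G_n(x, z) = ∑_k (-1)^k (∏_{i=0}^{n-k-1} (z + i)) / (k! (n-2k)!) (2x)^(n-2k)`. -/
noncomputable def gegenbauerParam (n : ℕ) (x : ℝ) : ℝ[X] :=
  ∑ k ∈ Finset.range (n / 2 + 1),
    C ((-1) ^ k * (2 * x) ^ (n - 2 * k) / ((k.factorial : ℝ) * ((n - 2 * k).factorial : ℝ))) *
      ∏ i ∈ Finset.range (n - k), (X + C (i : ℝ))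

/-- The modified Gegenbauer polynomial, that is, the Jacobi polynomial `P_n^(z-1/2, z-1/2)(x)`,
evaluated at the real point `x` and regarded as a polynomial in its parameter `z`
(the indeterminate). -/
noncomputable def modGegenbauerParam (n : ℕ) (x : ℝ) : ℝ[X] :=
  ∑ k ∈ Finset.range (n / 2 + 1),
    C ((-1) ^ k * x ^ (n - 2 * k) /
        ((k.factorial : ℝ) * ((n - 2 * k).factorial : ℝ) * 2 ^ (2 * k))) *
      ((∏ i ∈ Finset.Ico (n - n / 2) (n - k), (X + C (i : ℝ))) *
        ∏ i ∈ Finset.Ico (n / 2) n, (X + C (1 / 2 + (i : ℝ))))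

/-- The constant roots in `z`: the numbers that are a root for every value of `x`. -/
def modGegenbauerConstRoots (n : ℕ) : Set ℝ :=
  {z | ∀ x : ℝ, (modGegenbauerParam n x).IsRoot z}

/-- The nonconstant roots in `z` at the point `x`. -/
def modGegenbauerNonconstRoots (n : ℕ) (x : ℝ) : Set ℝ :=
  {z | (modGegenbauerParam n x).IsRoot z ∧ z ∉ modGegenbauerConstRoots n}

theorem prod_range_half (n : ℕ) :
    ∏ i ∈ Finset.range n, (X + C ((i : ℝ) / 2)) =
      (∏ i ∈ Finset.range (n - n / 2), (X + C (i : ℝ))) *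
        ∏ i ∈ Finset.range (n / 2), (X + C (1 / 2 + (i : ℝ))) := by
  induction n with
  | zero => simp
  | succ n ih =>
    rw [Finset.prod_range_succ, ih]
    rcases Nat.even_or_odd' n with ⟨m, rfl | rfl⟩
    · have h1 : 2 * m / 2 = m := by omega
      have h2 : (2 * m + 1) / 2 = m := by omega
      have h3 : 2 * m - m = m := by omega
      have h4 : 2 * m + 1 - m = m + 1 := by omega
      rw [h1, h2, h3, h4, Finset.prod_range_succ]
      have h5 : ((2 * m : ℕ) : ℝ) / 2 = m := by push_cast; ring
      rw [h5]; ring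
    · have h1 : (2 * m + 1) / 2 = m := by omega
      have h2 : (2 * m + 1 + 1) / 2 = m + 1 := by omega
      have h3 : 2 * m + 1 - m = m + 1 := by omega
      have h4 : 2 * m + 1 + 1 - (m + 1) = m + 1 := by omega
      rw [h1, h2, h3, h4, Finset.prod_range_succ _ m, Finset.prod_range_succ _ m]
      have h5 : ((2 * m + 1 : ℕ) : ℝ) / 2 = 1 / 2 + m := by push_cast; ring
      rw [h5]; ring

/-- The modified family is the rescaling of the Gegenbauer family by the factor
`∏_{i<n} (z + 1/2 + i) / (2^n ∏_{i<n} (z + i/2))`. -/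
theorem modGegenbauerParam_rescaling (n : ℕ) (x : ℝ) :
    C ((2 : ℝ) ^ n) * (∏ i ∈ Finset.range n, (X + C ((i : ℝ) / 2))) * modGegenbauerParam n x =
      (∏ i ∈ Finset.range n, (X + C (1 / 2 + (i : ℝ)))) * gegenbauerParam n x := by
  rw [prod_range_half, modGegenbauerParam, gegenbauerParam, Finset.mul_sum, Finset.mul_sum]
  refine Finset.sum_congr rfl fun k hk => ?_
  have hk' : k ≤ n / 2 := by simpa [Nat.lt_succ_iff] using hk
  rw [← Finset.prod_range_mul_prod_Ico (fun i : ℕ => (X + C (1 / 2 + (i : ℝ)) : ℝ[X]))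
      (show n / 2 ≤ n by omega),
    ← Finset.prod_range_mul_prod_Ico (fun i : ℕ => (X + C (i : ℝ) : ℝ[X]))
      (show n - n / 2 ≤ n - k by omega)]
  have hc : (-1 : ℝ) ^ k * (2 * x) ^ (n - 2 * k) /
      ((k.factorial : ℝ) * ((n - 2 * k).factorial : ℝ)) =
      2 ^ n * ((-1) ^ k * x ^ (n - 2 * k) /
        ((k.factorial : ℝ) * ((n - 2 * k).factorial : ℝ) * 2 ^ (2 * k))) := by
    have h2 : (2 : ℝ) ^ n = 2 ^ (n - 2 * k) * 2 ^ (2 * k) := by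
      rw [← pow_add]; congr 1; omega
    have := Nat.factorial_ne_zero k
    have := Nat.factorial_ne_zero (n - 2 * k)
    rw [h2, mul_pow]
    field_simp
  rw [hc, C_mul]
  ring

/-!
Write `n = 2 m + e` with `e ∈ {0, 1}` and `c = 1/2 + e`. Then `modGegenbauerParam n x` is the product
of a nonzero multiple of `x ^ e`, the factor `∏ i ∈ [m, n), (z + 1/2 + i)`, which does not depend on
`x`, and `₂F₁(-m, b; c; x²)` with `b = z + m + e` (`modGegenbauerParam_eq_hypPoly`). The second
factor carries exactly the constant roots, so everything reduces to the roots in `b` of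
`F(b, y) = ₂F₁(-m, b; c; y)` for `0 < y ≤ 1`.

The key fact is that for `0 < y < 1` these roots are real, greater than `c`, and more than `1` apart
(`exists_isSeparatedRootSeq`). It is proved by induction on `m`, for all `c > 0` at once, from a
recurrence that expresses `F` for `(m + 1, c)` at `b` by `F` for `(m, c + 1)` at `b` and `b + 1`: the
separation of the old roots produces the sign changes that locate and separate the new ones. At
`y = 1` the roots are `c, c + 1, …, c + m - 1`.

The separation also gives the monotonicity. Since `y ∂F/∂y = b (F(b + 1, y) - F(b, y))`, the
derivative in `y` at a root `b` has the sign of `F(b + 1, y)`, which is the sign of `F` immediately to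
the right of `b` because no root lies in `(b, b + 1]`. Hence each root strictly decreases in `y`
(`strictAntiOn_hypRoot`). As `y → 0`, `F` tends to `1` uniformly on compact sets, so all roots tend to
`+∞` (`tendsto_hypRoot_atTop`). The nonconstant roots are at least `1/2 - m`, and the constant ones at
most `-1/2 - m`, so all roots are simple.
-/

/-! ### The hypergeometric polynomial `₂F₁(-m, b; c; y)` in its parameter `b` -/

/-- The polynomial `₂F₁(-m, b; c; y) = ∑ⱼ (-1)^j (m choose j) (b)ⱼ / (c)ⱼ y^j`, where `(b)ⱼ` is the
rising factorial, as a polynomial in the indeterminate `b`. Up to normalization and an affine change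
of variable it is a Meixner polynomial. It is meaningful for `c > 0`, so that no `(c)ⱼ` vanishes. -/
noncomputable def hypPoly (m : ℕ) (c y : ℝ) : ℝ[X] :=
  ∑ j ∈ Finset.range (m + 1),
    C ((-1) ^ j * (m.choose j : ℝ) * y ^ j / (ascPochhammer ℝ j).eval c) * ascPochhammer ℝ j

theorem eval_hypPoly (m : ℕ) (c y b : ℝ) :
    (hypPoly m c y).eval b = ∑ j ∈ Finset.range (m + 1),
      (-1) ^ j * (m.choose j : ℝ) * y ^ j / (ascPochhammer ℝ j).eval c *
        (ascPochhammer ℝ j).eval b := by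
  simp [hypPoly, eval_finsetSum]

theorem natDegree_hypPoly_le (m : ℕ) (c y : ℝ) : (hypPoly m c y).natDegree ≤ m := by
  refine natDegree_sum_le_of_forall_le _ _ fun j hj => ?_
  refine (natDegree_C_mul_le _ _).trans ?_
  rw [ascPochhammer_natDegree]
  exact Nat.lt_succ_iff.mp (Finset.mem_range.mp hj)

theorem coeff_hypPoly_self (m : ℕ) (c y : ℝ) :
    (hypPoly m c y).coeff m = (-1) ^ m * (y ^ m / (ascPochhammer ℝ m).eval c) := by
  rw [hypPoly, finsetSum_coeff, Finset.sum_range_succ, Finset.sum_eq_zero]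
  · have h := (monic_ascPochhammer ℝ m).coeff_natDegree
    rw [ascPochhammer_natDegree] at h
    rw [coeff_C_mul, h]
    simp [mul_div_assoc]
  · intro j hj
    rw [coeff_C_mul, coeff_eq_zero_of_natDegree_lt, mul_zero]
    rw [ascPochhammer_natDegree]
    exact Finset.mem_range.mp hj

theorem ascPochhammer_eval_succ_left (j : ℕ) (b : ℝ) :
    (ascPochhammer ℝ (j + 1)).eval b = b * (ascPochhammer ℝ j).eval (b + 1) := by
  simp [ascPochhammer_succ_left, eval_comp]

theorem mul_ascPochhammer_eval_add_one (j : ℕ) (b : ℝ) :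
    b * (ascPochhammer ℝ j).eval (b + 1) = (ascPochhammer ℝ j).eval b * (b + j) := by
  rw [← ascPochhammer_eval_succ_left, ascPochhammer_succ_eval]

/-- The recurrence raising the degree `m` and lowering `c`, the difference operator of the Rodrigues
formula for Meixner polynomials. -/
theorem hypPoly_recurrence (m : ℕ) {c : ℝ} (hc : 0 < c) (y b : ℝ) :
    c * (hypPoly (m + 1) c y).eval b =
      (1 - y) * b * (hypPoly m (c + 1) y).eval (b + 1) +
        (c - b) * (hypPoly m (c + 1) y).eval b := by
  simp only [eval_hypPoly]
  have hp : ∀ j, (ascPochhammer ℝ j).eval c ≠ 0 := fun j => (ascPochhammer_pos j c hc).ne'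
  have hp1 : ∀ j, (ascPochhammer ℝ j).eval (c + 1) ≠ 0 :=
    fun j => (ascPochhammer_pos j _ (by linarith)).ne'
  set f : ℕ → ℝ := fun j => (-1) ^ j * (m.choose j : ℝ) * y ^ j / (ascPochhammer ℝ j).eval c *
        (ascPochhammer ℝ j).eval b * c with hf
  set g : ℕ → ℝ := fun j => (-1) ^ (j + 1) * (m.choose j : ℝ) * y ^ (j + 1) /
    (ascPochhammer ℝ (j + 1)).eval c * (ascPochhammer ℝ (j + 1)).eval b * c with hg
  -- The right-hand side contributes `f j` to the power `y ^ j` and `g j` to `y ^ (j + 1)`;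
  -- the two families recombine by Pascal's rule.
  have hR : ∀ j, (1 - y) * b * ((-1) ^ j * (m.choose j : ℝ) * y ^ j /
      (ascPochhammer ℝ j).eval (c + 1) * (ascPochhammer ℝ j).eval (b + 1)) +
      (c - b) * ((-1) ^ j * (m.choose j : ℝ) * y ^ j /
      (ascPochhammer ℝ j).eval (c + 1) * (ascPochhammer ℝ j).eval b) = f j + g j := by
    intro j
    have h1 := mul_ascPochhammer_eval_add_one j b
    have h2 := mul_ascPochhammer_eval_add_one j c
    have h3 := ascPochhammer_eval_succ_left j b
    have h4 := ascPochhammer_eval_succ_left j c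
    have h5 : (ascPochhammer ℝ j).eval c * (c + j) ≠ 0 := by
      rw [← h2]; exact mul_ne_zero hc.ne' (hp1 j)
    have h6 : c + j ≠ 0 := right_ne_zero_of_mul h5
    have h7 : (ascPochhammer ℝ j).eval (c + 1) = (ascPochhammer ℝ j).eval c * (c + j) / c := by
      field_simp; linarith
    simp only [hf, hg]
    rw [h3, h4, h7, h1]
    have := hp j
    have e : (1 - y) * b * ((-1) ^ j * (m.choose j : ℝ) * y ^ j /
      ((ascPochhammer ℝ j).eval c * (c + j) / c) * (ascPochhammer ℝ j).eval (b + 1)) =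
      (1 - y) * ((-1) ^ j * (m.choose j : ℝ) * y ^ j /
      ((ascPochhammer ℝ j).eval c * (c + j) / c)) * (b * (ascPochhammer ℝ j).eval (b + 1)) := by
      ring
    rw [e, h1]
    field_simp
    ring
  rw [Finset.mul_sum, Finset.mul_sum, Finset.mul_sum, ← Finset.sum_add_distrib,
    Finset.sum_congr rfl (fun j _ => hR j), Finset.sum_add_distrib, Finset.sum_range_succ' _ (m + 1)]
  have hf0 : ∑ j ∈ Finset.range (m + 1), f j = ∑ j ∈ Finset.range (m + 1), f (j + 1) + f 0 := by
    rw [← Finset.sum_range_succ' f (m + 1), Finset.sum_range_succ f (m + 1)]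
    simp [hf]
  rw [hf0, add_right_comm, ← Finset.sum_add_distrib]
  congr 1
  · refine Finset.sum_congr rfl fun j _ => ?_
    simp only [hf, hg, Nat.choose_succ_succ', Nat.cast_add]
    ring
  · simp [hf]

/-- The derivative in the argument `y` is, up to the factor `b / y`, the forward difference in the
parameter `b`. At a root `b` its sign is therefore that of the value at `b + 1`. -/
theorem hasDerivAt_hypPoly (m : ℕ) (c b y : ℝ) (hy : y ≠ 0) :
    HasDerivAt (fun t => (hypPoly m c t).eval b)
      (b * ((hypPoly m c y).eval (b + 1) - (hypPoly m c y).eval b) / y) y := by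
  simp only [eval_hypPoly]
  rw [← Finset.sum_sub_distrib, Finset.mul_sum, Finset.sum_div]
  refine HasDerivAt.fun_sum fun j _ => ?_
  have h := (((hasDerivAt_pow j y).const_mul ((-1) ^ j * (m.choose j : ℝ))).div_const
    ((ascPochhammer ℝ j).eval c)).mul_const ((ascPochhammer ℝ j).eval b)
  refine h.congr_deriv ?_
  have h1 := mul_ascPochhammer_eval_add_one j b
  have h2 : y * ((j : ℝ) * y ^ (j - 1)) = j * y ^ j := by
    cases j with
    | zero => simp
    | succ k => simp [pow_succ]; ring
  rw [eq_div_iff hy]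
  linear_combination ((-1) ^ j * (m.choose j : ℝ) / (ascPochhammer ℝ j).eval c *
    (ascPochhammer ℝ j).eval b) * h2 - (-1) ^ j * (m.choose j : ℝ) * y ^ j /
    (ascPochhammer ℝ j).eval c * h1

theorem continuous_hypPoly (m : ℕ) (c : ℝ) :
    Continuous fun p : ℝ × ℝ => (hypPoly m c p.1).eval p.2 := by
  simp only [eval_hypPoly]
  refine continuous_finsetSum _ fun j _ => ?_
  have := (ascPochhammer ℝ j).continuous
  fun_prop

theorem hypPoly_zero_right (m : ℕ) (c : ℝ) : hypPoly m c 0 = 1 := by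
  rw [hypPoly, Finset.sum_range_succ', Finset.sum_eq_zero]
  · simp
  · simp

/-- The Chu–Vandermonde identity: at `y = 1` the roots are `c, c + 1, …, c + m - 1`. The factor
`1 ^ m` keeps the shape of the factorization valid for all `y`. -/
theorem eval_hypPoly_one_right (m : ℕ) : ∀ {c : ℝ}, 0 < c → ∀ b : ℝ,
    (hypPoly m c 1).eval b =
      1 ^ m / (ascPochhammer ℝ m).eval c * ∏ i ∈ Finset.range m, (c + i - b) := by
  induction m with
  | zero => intro c _ b; simp [eval_hypPoly]
  | succ m ih =>
    intro c hc b
    have h := hypPoly_recurrence m hc 1 b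
    rw [ih (by linarith : 0 < c + 1) b] at h
    have hp := (ascPochhammer_pos m (c + 1) (by linarith)).ne'
    rw [Finset.prod_range_succ', ascPochhammer_eval_succ_left]
    have e : ∏ i ∈ Finset.range m, (c + ((i + 1 : ℕ) : ℝ) - b) =
        ∏ i ∈ Finset.range m, (c + 1 + i - b) :=
      Finset.prod_congr rfl fun i _ => by push_cast; ring
    rw [e]
    refine mul_left_cancel₀ hc.ne' (h.trans ?_)
    field_simp
    ring

/-- Any `m` distinct roots yield the full factorization; the leading coefficient is
`(-1)^m y^m / (c)ₘ`. -/
theorem eval_hypPoly_eq_prod {m : ℕ} {c y : ℝ} {s : ℕ → ℝ}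
    (hs : ∀ i < m, (hypPoly m c y).eval (s i) = 0) (hinj : Set.InjOn s (Set.Iio m)) (b : ℝ) :
    (hypPoly m c y).eval b =
      y ^ m / (ascPochhammer ℝ m).eval c * ∏ i ∈ Finset.range m, (s i - b) := by
  set K := y ^ m / (ascPochhammer ℝ m).eval c
  set q : ℝ[X] := C ((-1) ^ m * K) * ∏ i ∈ Finset.range m, (X - C (s i)) with hq
  have hmon : (∏ i ∈ Finset.range m, (X - C (s i))).Monic := monic_prod_X_sub_C _ _
  have hdeg : (∏ i ∈ Finset.range m, (X - C (s i))).natDegree = m := by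
    simp
  have hqn : q.natDegree ≤ m := (natDegree_C_mul_le _ _).trans hdeg.le
  have hqc : q.coeff m = (-1) ^ m * K := by
    have := hmon.coeff_natDegree
    rw [hdeg] at this
    rw [hq, coeff_C_mul, this, mul_one]
  have hcard : ((Finset.range m).image s).card = m := by
    rw [Finset.card_image_of_injOn, Finset.card_range]
    simpa using hinj
  have key : hypPoly m c y = q := by
    refine eq_of_degree_sub_lt_of_eval_finset_eq ((Finset.range m).image s) ?_ ?_
    · rw [hcard, degree_lt_iff_coeff_zero]
      intro k hk
      rcases hk.eq_or_lt with rfl | hk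
      · rw [coeff_sub, coeff_hypPoly_self, hqc, sub_self]
      · rw [coeff_sub, coeff_eq_zero_of_natDegree_lt ((natDegree_hypPoly_le _ _ _).trans_lt hk),
          coeff_eq_zero_of_natDegree_lt (hqn.trans_lt hk), sub_self]
    · intro t ht
      obtain ⟨i, hi, rfl⟩ := Finset.mem_image.mp ht
      rw [hs i (Finset.mem_range.mp hi), hq, eval_mul, eval_prod,
        Finset.prod_eq_zero hi (by simp), mul_zero]
  rw [key, hq, eval_mul, eval_C, eval_prod, mul_comm _ K, mul_assoc]
  congr 1
  have : ((-1 : ℝ) ^ m) = ∏ i ∈ Finset.range m, (-1 : ℝ) := by simp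
  rw [this, ← Finset.prod_mul_distrib]
  exact Finset.prod_congr rfl fun i _ => by simp

theorem neg_one_pow_mul_prod_sub_pos {m j : ℕ} (hj : j ≤ m) {r : ℕ → ℝ} {b : ℝ}
    (h1 : ∀ i < j, r i < b) (h2 : ∀ i, j ≤ i → i < m → b < r i) :
    0 < (-1) ^ j * ∏ i ∈ Finset.range m, (r i - b) := by
  rw [← Finset.prod_range_mul_prod_Ico _ hj, ← mul_assoc]
  refine mul_pos ?_ (Finset.prod_pos fun i hi => ?_)
  · have : ((-1 : ℝ) ^ j) = ∏ i ∈ Finset.range j, (-1 : ℝ) := by simp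
    rw [this, ← Finset.prod_mul_distrib]
    exact Finset.prod_pos fun i hi => by linarith [h1 i (Finset.mem_range.mp hi)]
  · obtain ⟨a, b⟩ := Finset.mem_Ico.mp hi
    linarith [h2 i a b]

/-! ### Roots in the parameter: reality and separation -/

/-- The values `r 0, …, r (m - 1)` are roots of `₂F₁(-m, ·; c; y)`, with `r i > c + i` and with
consecutive values more than `1` apart. The values `r i` for `i ≥ m` are irrelevant. -/
structure IsSeparatedRootSeq (m : ℕ) (c y : ℝ) (r : ℕ → ℝ) : Prop where
  root : ∀ i < m, (hypPoly m c y).eval (r i) = 0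
  lower : ∀ i < m, c + i < r i
  gap : ∀ i, i + 1 < m → r i + 1 < r (i + 1)

namespace IsSeparatedRootSeq

variable {m : ℕ} {c y : ℝ} {r : ℕ → ℝ}

theorem add_one_lt (h : IsSeparatedRootSeq m c y r) {i j : ℕ} (hij : i < j) (hj : j < m) :
    r i + 1 < r j := by
  induction j, hij using Nat.le_induction with
  | base => exact h.gap i hj
  | succ k _ ih => linarith [ih (by omega), h.gap k hj]

theorem injOn (h : IsSeparatedRootSeq m c y r) : Set.InjOn r (Set.Iio m) := by
  intro i hi j hj hij
  rcases lt_trichotomy i j with hlt | heq | hlt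
  · linarith [h.add_one_lt hlt hj]
  · exact heq
  · linarith [h.add_one_lt hlt hi]

theorem eval_eq (h : IsSeparatedRootSeq m c y r) (b : ℝ) :
    (hypPoly m c y).eval b =
      y ^ m / (ascPochhammer ℝ m).eval c * ∏ i ∈ Finset.range m, (r i - b) :=
  eval_hypPoly_eq_prod h.root h.injOn b

theorem sign_eval (h : IsSeparatedRootSeq m c y r) (hc : 0 < c) (hy : 0 < y) {j : ℕ}
    (hj : j ≤ m) {b : ℝ} (h1 : ∀ i < j, r i < b) (h2 : ∀ i, j ≤ i → i < m → b < r i) :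
    0 < (-1) ^ j * (hypPoly m c y).eval b := by
  rw [h.eval_eq, mul_left_comm]
  exact mul_pos (div_pos (pow_pos hy _) (ascPochhammer_pos m c hc))
    (neg_one_pow_mul_prod_sub_pos hj h1 h2)

end IsSeparatedRootSeq

/-- Far to the right the polynomial has the sign `(-1)^m` of its leading coefficient. -/
theorem exists_gt_sign_hypPoly {m : ℕ} (hm : m ≠ 0) {c y : ℝ} (hc : 0 < c) (hy : 0 < y) (a : ℝ) :
    ∃ B, a < B ∧ 0 < (-1) ^ m * (hypPoly m c y).eval B := by
  set p : ℝ[X] := C ((-1) ^ m) * hypPoly m c y with hp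
  have hK : 0 < y ^ m / (ascPochhammer ℝ m).eval c :=
    div_pos (pow_pos hy _) (ascPochhammer_pos m c hc)
  have hcoeff : p.coeff m = y ^ m / (ascPochhammer ℝ m).eval c := by
    rw [hp, coeff_C_mul, coeff_hypPoly_self, ← mul_assoc, ← mul_pow]
    simp
  have hdeg : p.natDegree = m :=
    natDegree_eq_of_le_of_coeff_ne_zero ((natDegree_C_mul_le _ _).trans (natDegree_hypPoly_le _ _ _))
      (by rw [hcoeff]; exact hK.ne')
  have ht := p.tendsto_atTop_of_leadingCoeff_nonneg
    (natDegree_pos_iff_degree_pos.mp (by omega)) (by rw [leadingCoeff, hdeg, hcoeff]; exact hK.le)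
  obtain ⟨B, hB, hB'⟩ := ((Filter.eventually_gt_atTop a).and (ht.eventually_gt_atTop 0)).exists
  exact ⟨B, hB, by simpa [hp] using hB'⟩

/-- For `0 < y < 1` the polynomial has `m` real roots, more than `1` apart and above `c`. In the
inductive step let `r` be the roots for `(m, c + 1)`. At `r k` and at `r (k + 1) - 1` only one term
of `hypPoly_recurrence` survives, and the separation of `r` makes the two values have opposite
signs. The new roots thus lie in the intervals `(c, r 0 - 1)`, `(r k, r (k + 1) - 1)` and
`(r (m - 1), ∞)`, which are themselves more than `1` apart. -/
theorem exists_isSeparatedRootSeq (m : ℕ) {y : ℝ} (hy : 0 < y) (hy1 : y < 1) :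
    ∀ {c : ℝ}, 0 < c → ∃ r, IsSeparatedRootSeq m c y r := by
  induction m with
  | zero => exact fun _ => ⟨0, by simp, by simp, by simp⟩
  | succ m ih =>
    intro c hc
    obtain ⟨r, hr⟩ := ih (by linarith : 0 < c + 1)
    have hc1 : 0 < c + 1 := by linarith
    have hrec := hypPoly_recurrence m hc y
    -- The left endpoints of the intervals that isolate the new roots.
    set u : ℕ → ℝ := fun i => if i = 0 then c else r (i - 1) with hu
    have hu0 : u 0 = c := by simp [hu]
    have hus : ∀ k, u (k + 1) = r k := fun k => by simp [hu]
    have hA : ∀ i ≤ m, 0 < (-1) ^ i * (hypPoly (m + 1) c y).eval (u i) := by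
      intro i hi
      refine pos_of_mul_pos_right ?_ hc.le
      rw [mul_left_comm, hrec]
      rcases i with _ | k
      · have := hr.sign_eval hc1 hy (j := 0) (Nat.zero_le m) (b := c + 1) (by simp)
          (fun i _ hi => by have := hr.lower i hi; have : (0 : ℝ) ≤ i := i.cast_nonneg; linarith)
        rw [hu0]
        have h2 := mul_pos (mul_pos (sub_pos.mpr hy1) hc) this
        linarith
      · have := hr.sign_eval hc1 hy (j := k + 1) hi (b := r k + 1)
          (fun i hik => by
            rcases (Nat.lt_succ_iff.mp hik).eq_or_lt with rfl | h
            · linarith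
            · linarith [hr.add_one_lt h hi])
          (fun i hik him => hr.add_one_lt hik him)
        have hrk : 0 < r k := by
          have := hr.lower k hi
          have : (0 : ℝ) ≤ k := k.cast_nonneg
          linarith
        rw [hus, hr.root k hi]
        have h2 := mul_pos (mul_pos (sub_pos.mpr hy1) hrk) this
        linarith
    have hB : ∀ i ≤ m, ∃ v, u i < v ∧ (i < m → v = r i - 1) ∧
        0 < (-1) ^ (i + 1) * (hypPoly (m + 1) c y).eval v := by
      intro i hi
      rcases hi.lt_or_eq with him | rfl
      · refine ⟨r i - 1, ?_, fun _ => rfl, ?_⟩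
        · rcases i with _ | k
          · rw [hu0]; have := hr.lower 0 him; simp at this; linarith
          · rw [hus]; linarith [hr.gap k him]
        · refine pos_of_mul_pos_right ?_ hc.le
          rw [mul_left_comm, hrec, sub_add_cancel, hr.root i him]
          have h1 := hr.sign_eval hc1 hy hi (b := r i - 1)
            (fun j hj => by linarith [hr.add_one_lt hj him])
            (fun j hj hjm => by
              rcases hj.eq_or_lt with rfl | h
              · linarith
              · linarith [hr.add_one_lt h hjm])
          have h2 : 0 < r i - 1 - c := by
            have := hr.lower i him
            have : (0 : ℝ) ≤ i := i.cast_nonneg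
            linarith
          have h3 := mul_pos h2 h1
          rw [pow_succ]
          linarith
      · obtain ⟨B, hB, hB'⟩ := exists_gt_sign_hypPoly i.succ_ne_zero hc hy (u i)
        exact ⟨B, hB, fun h => absurd h (lt_irrefl _), hB'⟩
    have hT : ∀ i, ∃ t, i ≤ m → u i < t ∧ (i < m → t < r i - 1) ∧
        (hypPoly (m + 1) c y).eval t = 0 := by
      intro i
      by_cases hi : i ≤ m
      · obtain ⟨v, huv, hv, hsv⟩ := hB i hi
        have hcont : ContinuousOn (fun b => (-1) ^ i * (hypPoly (m + 1) c y).eval b)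
            (Set.Icc (u i) v) :=
          (continuous_const.mul (hypPoly (m + 1) c y).continuous).continuousOn
        obtain ⟨t, ht, ht0⟩ := intermediate_value_Ioo' huv.le hcont
          (show (0 : ℝ) ∈ Set.Ioo _ _ from ⟨by rw [pow_succ] at hsv; linarith, hA i hi⟩)
        refine ⟨t, fun _ => ⟨ht.1, fun him => hv him ▸ ht.2, ?_⟩⟩
        exact (mul_eq_zero.mp ht0).resolve_left (pow_ne_zero _ (by norm_num))
      · exact ⟨0, fun h => absurd h hi⟩
    choose t ht using hT
    refine ⟨t, fun i hi => (ht i (by omega)).2.2, fun i hi => ?_, fun i hi => ?_⟩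
    · have h1 := (ht i (by omega)).1
      rcases i with _ | k
      · rw [hu0] at h1; simpa using h1
      · rw [hus] at h1
        have := hr.lower k (by omega)
        push_cast; linarith
    · have h1 := (ht i (by omega)).2.1 (by omega)
      have h2 := (ht (i + 1) (by omega)).1
      rw [hus] at h2
      linarith

open Classical in
/-- The `i`-th smallest root, counted from `i = 0`, of `₂F₁(-m, ·; c; y)` for `0 < c`, `0 < y ≤ 1`
and `i < m`. For `y = 1` the explicit value `c + i` is used, because there the gaps are exactly `1`
and `IsSeparatedRootSeq` fails. Other arguments give junk values. -/
noncomputable def hypRoot (m : ℕ) (c y : ℝ) : ℕ → ℝ :=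
  if h : 0 < c ∧ 0 < y ∧ y < 1 then (exists_isSeparatedRootSeq m h.2.1 h.2.2 h.1).choose
  else fun i => c + i

theorem isSeparatedRootSeq_hypRoot (m : ℕ) {c y : ℝ} (hc : 0 < c) (hy : 0 < y) (hy1 : y < 1) :
    IsSeparatedRootSeq m c y (hypRoot m c y) := by
  rw [hypRoot, dif_pos ⟨hc, hy, hy1⟩]
  exact (exists_isSeparatedRootSeq m hy hy1 hc).choose_spec

theorem hypRoot_one_right (m : ℕ) (c : ℝ) : hypRoot m c 1 = fun i : ℕ => c + i := by
  rw [hypRoot, dif_neg (fun h => lt_irrefl _ h.2.2)]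

/-! ### Dependence of the roots on the argument -/

theorem hypRoot_lower (m : ℕ) {c y : ℝ} (hc : 0 < c) (hy : y ∈ Set.Ioc (0 : ℝ) 1) {i : ℕ}
    (hi : i < m) : c + i ≤ hypRoot m c y i := by
  rcases hy.2.lt_or_eq with h | rfl
  · exact ((isSeparatedRootSeq_hypRoot m hc hy.1 h).lower i hi).le
  · rw [hypRoot_one_right]

theorem hypRoot_strictMonoOn (m : ℕ) {c y : ℝ} (hc : 0 < c) (hy : y ∈ Set.Ioc (0 : ℝ) 1) :
    StrictMonoOn (hypRoot m c y) (Set.Iio m) := by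
  intro i _ j hj hij
  rcases hy.2.lt_or_eq with h | rfl
  · linarith [(isSeparatedRootSeq_hypRoot m hc hy.1 h).add_one_lt hij hj]
  · rw [hypRoot_one_right]
    simpa using hij

theorem eval_hypPoly_eq (m : ℕ) {c y : ℝ} (hc : 0 < c) (hy : y ∈ Set.Ioc (0 : ℝ) 1) (b : ℝ) :
    (hypPoly m c y).eval b =
      y ^ m / (ascPochhammer ℝ m).eval c * ∏ i ∈ Finset.range m, (hypRoot m c y i - b) := by
  rcases hy.2.lt_or_eq with h | rfl
  · exact (isSeparatedRootSeq_hypRoot m hc hy.1 h).eval_eq b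
  · rw [hypRoot_one_right, eval_hypPoly_one_right m hc]

theorem eval_hypPoly_eq_zero_iff (m : ℕ) {c y : ℝ} (hc : 0 < c) (hy : y ∈ Set.Ioc (0 : ℝ) 1)
    (b : ℝ) : (hypPoly m c y).eval b = 0 ↔ ∃ i < m, hypRoot m c y i = b := by
  have hK : y ^ m / (ascPochhammer ℝ m).eval c ≠ 0 :=
    (div_pos (pow_pos hy.1 _) (ascPochhammer_pos m c hc)).ne'
  simp [eval_hypPoly_eq m hc hy, hK, Finset.prod_eq_zero_iff, sub_eq_zero]

theorem eq_hypRoot {m : ℕ} {c y : ℝ} (hc : 0 < c) (hy : y ∈ Set.Ioc (0 : ℝ) 1) {s : ℕ → ℝ}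
    (hs : ∀ i < m, (hypPoly m c y).eval (s i) = 0) (hmono : StrictMonoOn s (Set.Iio m))
    {i : ℕ} (hi : i < m) : s i = hypRoot m c y i := by
  have hK : y ^ m / (ascPochhammer ℝ m).eval c ≠ 0 :=
    (div_pos (pow_pos hy.1 _) (ascPochhammer_pos m c hc)).ne'
  have h1 : StrictMono fun k : Fin m => s k := fun a b hab => hmono a.2 b.2 hab
  have h2 : StrictMono fun k : Fin m => hypRoot m c y k :=
    fun a b hab => hypRoot_strictMonoOn m hc hy a.2 b.2 hab
  refine congrFun ((StrictMono.range_inj h1 h2).mp (Set.ext fun b => ?_)) ⟨i, hi⟩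
  have h3 : (hypPoly m c y).eval b = 0 ↔ ∃ i < m, s i = b := by
    simp [eval_hypPoly_eq_prod hs hmono.injOn, hK, Finset.prod_eq_zero_iff, sub_eq_zero]
  have h4 := h3.symm.trans (eval_hypPoly_eq_zero_iff m hc hy b)
  simpa [Fin.exists_iff] using h4

/-- Continuity of the roots: the sign change across `(r i - ε, r i + ε)` persists for nearby `y`, and
these intervals are disjoint because the roots are more than `1` apart, so each one holds exactly
the `i`-th root. -/
theorem eventually_abs_hypRoot_sub_lt (m : ℕ) {c y₀ ε : ℝ} (hc : 0 < c) (hy₀ : 0 < y₀)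
    (hy₀1 : y₀ < 1) (hε : 0 < ε) (hε2 : ε ≤ 1 / 2) :
    ∀ᶠ y in nhds y₀, ∀ i < m, |hypRoot m c y i - hypRoot m c y₀ i| < ε := by
  have hr := isSeparatedRootSeq_hypRoot m hc hy₀ hy₀1
  set r := hypRoot m c y₀ with hrdef
  have hcont : ∀ b, Continuous fun y => (hypPoly m c y).eval b := fun b =>
    (continuous_hypPoly m c).comp (continuous_id.prodMk continuous_const)
  have hsign : ∀ i ∈ Finset.range m, ∀ᶠ y in nhds y₀,
      0 < (-1) ^ i * (hypPoly m c y).eval (r i - ε) ∧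
      0 < (-1) ^ (i + 1) * (hypPoly m c y).eval (r i + ε) := by
    intro i hi
    have him := Finset.mem_range.mp hi
    refine Filter.Eventually.and ?_ ?_
    · refine ((continuous_const.mul (hcont _)).continuousAt).eventually_const_lt ?_
      refine hr.sign_eval hc hy₀ him.le (fun j hj => ?_) (fun j hj hjm => ?_)
      · linarith [hr.add_one_lt hj him]
      · rcases hj.eq_or_lt with rfl | h
        · linarith
        · linarith [hr.add_one_lt h hjm]
    · refine ((continuous_const.mul (hcont _)).continuousAt).eventually_const_lt ?_
      refine hr.sign_eval hc hy₀ him (fun j hj => ?_) (fun j hj hjm => ?_)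
      · rcases (Nat.lt_succ_iff.mp hj).eq_or_lt with rfl | h
        · linarith
        · linarith [hr.add_one_lt h him]
      · linarith [hr.add_one_lt hj hjm]
  filter_upwards [(Filter.eventually_all_finset _).mpr hsign, Ioo_mem_nhds hy₀ hy₀1] with y hy hy01
  have hT : ∀ i, ∃ t, i < m → r i - ε < t ∧ t < r i + ε ∧ (hypPoly m c y).eval t = 0 := by
    intro i
    by_cases hi : i < m
    · obtain ⟨h1, h2⟩ := hy i (Finset.mem_range.mpr hi)
      have hcont : ContinuousOn (fun b => (-1) ^ i * (hypPoly m c y).eval b)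
          (Set.Icc (r i - ε) (r i + ε)) :=
        (continuous_const.mul (hypPoly m c y).continuous).continuousOn
      obtain ⟨t, ht, ht0⟩ := intermediate_value_Ioo' (by linarith) hcont
        (show (0 : ℝ) ∈ Set.Ioo _ _ from ⟨by rw [pow_succ] at h2; linarith, h1⟩)
      exact ⟨t, fun _ => ⟨ht.1, ht.2,
        (mul_eq_zero.mp ht0).resolve_left (pow_ne_zero _ (by norm_num))⟩⟩
    · exact ⟨0, fun h => absurd h hi⟩
  choose s hs using hT
  intro i hi
  rw [← eq_hypRoot hc ⟨hy01.1, hy01.2.le⟩ (s := s) (fun j hj => (hs j hj).2.2) ?_ hi, abs_lt]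
  · constructor <;> linarith [(hs i hi).1, (hs i hi).2.1]
  · intro j hj k hk hjk
    linarith [(hs j hj).2.1, (hs k hk).1, hr.add_one_lt hjk hk]

theorem continuousOn_hypRoot {m i : ℕ} (hi : i < m) {c : ℝ} (hc : 0 < c) :
    ContinuousOn (fun y => hypRoot m c y i) (Set.Ioo 0 1) := by
  intro y₀ hy₀
  refine ContinuousAt.continuousWithinAt (Metric.tendsto_nhds.mpr fun ε hε => ?_)
  filter_upwards [eventually_abs_hypRoot_sub_lt m hc hy₀.1 hy₀.2
    (lt_min hε one_half_pos) (min_le_right ε (1 / 2))] with y hy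
  exact (hy i hi).trans_le (min_le_left _ _)

/-- Locally the roots increase when `y` decreases: by `hasDerivAt_hypPoly` the derivative in `y` at
the root `b = r i` has the sign of the value at `b + 1`, and this is `(-1)^(i + 1)` because the next
root lies beyond `b + 1`. -/
theorem eventually_lt_hypRoot {m i : ℕ} (hi : i < m) {c y₀ : ℝ} (hc : 0 < c) (hy₀ : 0 < y₀)
    (hy₀1 : y₀ < 1) :
    ∀ᶠ y in nhds y₀, y < y₀ → hypRoot m c y₀ i < hypRoot m c y i := by
  have hr := isSeparatedRootSeq_hypRoot m hc hy₀ hy₀1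
  set b := hypRoot m c y₀ i with hb
  have hb0 : 0 < b := by
    have := hr.lower i hi
    have : (0 : ℝ) ≤ i := i.cast_nonneg
    linarith
  have hF : (hypPoly m c y₀).eval b = 0 := hr.root i hi
  have hderiv := (hasDerivAt_hypPoly m c b y₀ hy₀.ne').const_mul ((-1 : ℝ) ^ (i + 1))
  have hpos : 0 < deriv (fun t => (-1) ^ (i + 1) * (hypPoly m c t).eval b) y₀ := by
    have h1 := hr.sign_eval hc hy₀ (j := i + 1) hi (b := b + 1)
      (fun j hj => by
        rcases (Nat.lt_succ_iff.mp hj).eq_or_lt with rfl | h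
        · linarith
        · linarith [hr.add_one_lt h hi])
      (fun j hj hjm => hr.add_one_lt hj hjm)
    rw [hderiv.deriv, hF, sub_zero, mul_div_assoc', mul_left_comm]
    exact div_pos (mul_pos hb0 h1) hy₀
  have hsg := eventually_nhdsWithin_sign_eq_of_deriv_pos hpos (by simp [hF])
  filter_upwards [hsg, Ioo_mem_nhds hy₀ hy₀1,
    eventually_abs_hypRoot_sub_lt m hc hy₀ hy₀1 one_half_pos le_rfl] with y hy hy01 hclose hlt
  have hr' := isSeparatedRootSeq_hypRoot m hc hy01.1 hy01.2
  rw [sign_neg (sub_neg.mpr hlt), sign_eq_neg_one_iff] at hy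
  by_contra! hle
  rcases hle.lt_or_eq with h | h
  -- A root `hypRoot m c y i < b` would leave exactly `i + 1` roots below `b`,
  -- and the polynomial would have the wrong sign at `b`.
  · have := hr'.sign_eval hc hy01.1 (j := i + 1) hi (b := b)
      (fun j hj => by
        rcases (Nat.lt_succ_iff.mp hj).eq_or_lt with rfl | h'
        · exact h
        · exact (hr'.add_one_lt h' hi).trans' (lt_add_one _) |>.trans h)
      (fun j hj hjm => by
        have h2 := (abs_lt.mp (hclose j hjm)).1
        have h3 := hr.add_one_lt hj hjm
        linarith)
    linarith
  · rw [← h, hr'.root i hi] at hy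
    simp at hy

/-- A continuous function on an interval that is strictly larger just to the left of every point is
strictly decreasing: on `[a, b]` its maximum can only be attained at `a`. -/
theorem strictAntiOn_of_eventually_lt {f : ℝ → ℝ} {s : Set ℝ} (hs : s.OrdConnected)
    (hf : ContinuousOn f s) (h : ∀ t ∈ s, ∀ᶠ u in nhds t, u < t → f t < f u) :
    StrictAntiOn f s := by
  intro a ha b hb hab
  have hsub : Set.Icc a b ⊆ s := hs.out ha hb
  have key : ∀ t ∈ Set.Icc a b, IsMaxOn f (Set.Icc a b) t → t = a := by
    intro t ht hmax
    by_contra hne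
    have hat : a < t := lt_of_le_of_ne ht.1 (Ne.symm hne)
    obtain ⟨u, hu, hu1, hu2⟩ := (((h t (hsub ht)).filter_mono nhdsWithin_le_nhds).and
      (Ioo_mem_nhdsLT hat)).exists
    exact absurd (hmax ⟨hu1.le, hu2.le.trans ht.2⟩) (not_le.mpr (hu hu2))
  obtain ⟨t, ht, hmax⟩ := isCompact_Icc.exists_isMaxOn ⟨a, le_rfl, hab.le⟩ (hf.mono hsub)
  obtain rfl := key t ht hmax
  refine lt_of_le_of_ne (hmax (Set.right_mem_Icc.mpr hab.le)) fun heq => hab.ne' ?_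
  exact key b (Set.right_mem_Icc.mpr hab.le) fun u hu => (hmax hu).trans heq.ge

theorem strictAntiOn_hypRoot {m i : ℕ} (hi : i < m) {c : ℝ} (hc : 0 < c) :
    StrictAntiOn (fun y => hypRoot m c y i) (Set.Ioc 0 1) := by
  have h := strictAntiOn_of_eventually_lt Set.ordConnected_Ioo (continuousOn_hypRoot hi hc)
    fun t ht => eventually_lt_hypRoot hi hc ht.1 ht.2
  intro a ha b hb hab
  -- At `y = 1` the `i`-th root is `c + i`, the strict lower bound valid for `y < 1`.
  rcases hb.2.lt_or_eq with hb1 | rfl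
  · exact h ⟨ha.1, hab.trans hb1⟩ ⟨hb.1, hb1⟩ hab
  · simpa only [hypRoot_one_right] using (isSeparatedRootSeq_hypRoot m hc ha.1 hab).lower i hi

/-- The polynomial tends to `1` uniformly on compact sets as `y → 0`, so its roots leave every
compact set. -/
theorem tendsto_hypRoot_atTop {m i : ℕ} (hi : i < m) {c : ℝ} (hc : 0 < c) :
    Filter.Tendsto (fun y => hypRoot m c y i) (nhdsWithin 0 (Set.Ioi 0)) Filter.atTop := by
  refine Filter.tendsto_atTop.mpr fun B => ?_
  have h : ∀ᶠ y in nhds (0 : ℝ), ∀ b ∈ Set.Icc c B, (hypPoly m c y).eval b ≠ 0 := by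
    refine isCompact_Icc.eventually_forall_of_forall_eventually fun b _ => ?_
    refine (continuous_hypPoly m c).continuousAt.eventually_ne ?_
    simp [hypPoly_zero_right]
  filter_upwards [h.filter_mono nhdsWithin_le_nhds, Ioo_mem_nhdsGT (zero_lt_one' ℝ)] with y hy hy01
  have hr := isSeparatedRootSeq_hypRoot m hc hy01.1 hy01.2
  by_contra! hlt
  have hl := hr.lower i hi
  have : (0 : ℝ) ≤ i := i.cast_nonneg
  exact hy _ ⟨by linarith, hlt.le⟩ (hr.root i hi)

/-! ### Factorization of the modified Gegenbauer polynomial -/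

/-- The duplication formula `(2j)! = 4^j j! (1/2)ⱼ`. -/
theorem factorial_two_mul_eq (j : ℕ) :
    ((2 * j).factorial : ℝ) = 4 ^ j * j.factorial * (ascPochhammer ℝ j).eval (1 / 2) := by
  induction j with
  | zero => simp
  | succ j ih =>
    rw [show 2 * (j + 1) = 2 * j + 1 + 1 by ring, Nat.factorial_succ, Nat.factorial_succ,
      ascPochhammer_succ_eval, Nat.factorial_succ]
    push_cast
    rw [ih]
    ring

/-- The duplication formula `(2j+1)! = 4^j j! (3/2)ⱼ`. -/
theorem factorial_two_mul_add_one_eq (j : ℕ) :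
    ((2 * j + 1).factorial : ℝ) = 4 ^ j * j.factorial * (ascPochhammer ℝ j).eval (1 / 2 + 1) := by
  have h := mul_ascPochhammer_eval_add_one j (1 / 2)
  rw [Nat.factorial_succ]
  push_cast
  rw [factorial_two_mul_eq]
  linear_combination (-2 * 4 ^ j * (j.factorial : ℝ)) * h

theorem ascPochhammer_comp_X_add_C (a j : ℕ) :
    (ascPochhammer ℝ j).comp (X + C (a : ℝ)) = ∏ i ∈ Finset.Ico a (a + j), (X + C (i : ℝ)) := by
  induction j with
  | zero => simp
  | succ j ih =>
    rw [← add_assoc, Finset.prod_Ico_succ_top (Nat.le_add_right a j), ← ih, ascPochhammer_succ_right]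
    simp [add_assoc]

/-- The substitution `k = m - j` turns the sum for degree `n = 2 m + e` into a multiple of
`₂F₁(-m, z + m + e; 1/2 + e; x²)`; the remaining factor in `z` does not depend on `x`. -/
theorem modGegenbauerParam_eq_hypPoly (m e : ℕ) (he : e < 2) (x : ℝ) :
    modGegenbauerParam (2 * m + e) x =
      C ((-1) ^ m * x ^ e / (m.factorial * 4 ^ m)) *
        ((hypPoly m (1 / 2 + e) (x ^ 2)).comp (X + C ((m + e : ℕ) : ℝ)) *
          ∏ i ∈ Finset.Ico m (2 * m + e), (X + C (1 / 2 + (i : ℝ)))) := by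
  have h1 : (2 * m + e) / 2 = m := by omega
  have h2 : 2 * m + e - m = m + e := by omega
  rw [modGegenbauerParam, h1, h2, hypPoly, Polynomial.sum_comp, Finset.sum_mul, Finset.mul_sum,
    ← Finset.sum_range_reflect]
  refine Finset.sum_congr rfl fun j hj => ?_
  have hj' : j ≤ m := Nat.lt_succ_iff.mp (Finset.mem_range.mp hj)
  have h3 : m + 1 - 1 - j = m - j := by omega
  have h4 : 2 * m + e - 2 * (m - j) = 2 * j + e := by omega
  have h5 : 2 * m + e - (m - j) = m + e + j := by omega
  rw [h3, h4, h5, mul_comp, C_comp, ascPochhammer_comp_X_add_C, ← mul_assoc, ← mul_assoc,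
    ← mul_assoc, ← C_mul]
  congr 3
  have hfac : ((2 * j + e).factorial : ℝ) =
      4 ^ j * j.factorial * (ascPochhammer ℝ j).eval (1 / 2 + (e : ℝ)) := by
    interval_cases e
    · simpa using factorial_two_mul_eq j
    · simpa using factorial_two_mul_add_one_eq j
  have hm4 : (4 : ℝ) ^ m = 4 ^ (m - j) * 4 ^ j := by rw [← pow_add, Nat.sub_add_cancel hj']
  have hm1 : (-1 : ℝ) ^ m = (-1) ^ (m - j) * (-1) ^ j := by
    rw [← pow_add, Nat.sub_add_cancel hj']
  have hj1 : ((-1 : ℝ) ^ j) ^ 2 = 1 := by rw [← pow_mul, mul_comm, pow_mul]; simp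
  have hch : (m.choose j : ℝ) = m.factorial / (j.factorial * (m - j).factorial) :=
    Nat.cast_choose ℝ hj'
  have f1 : (m.factorial : ℝ) ≠ 0 := by positivity
  have f2 : (j.factorial : ℝ) ≠ 0 := by positivity
  have f3 : ((m - j).factorial : ℝ) ≠ 0 := by positivity
  rw [hfac, hm4, hm1, hch, pow_mul, pow_add, pow_mul x 2 j]
  norm_num only
  field_simp
  rw [hj1, mul_one]

theorem degree_splits_simple_of_eq_prod {K : ℝ} (hK : K ≠ 0) (S : Finset ℝ) :
    (C K * ∏ a ∈ S, (X - C a)).degree = (S.card : WithBot ℕ) ∧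
      (C K * ∏ a ∈ S, (X - C a)).Splits ∧
      ∀ z : ℝ, (C K * ∏ a ∈ S, (X - C a)).IsRoot z →
        (C K * ∏ a ∈ S, (X - C a)).rootMultiplicity z = 1 := by
  have hmon : (∏ a ∈ S, (X - C a) : ℝ[X]).Monic := monic_prod_X_sub_C _ _
  have hroots : (C K * ∏ a ∈ S, (X - C a)).roots = S.val := by
    rw [roots_C_mul _ hK, roots_prod_X_sub_C]
  have hne : C K * ∏ a ∈ S, (X - C a) ≠ 0 := mul_ne_zero (C_ne_zero.mpr hK) hmon.ne_zero
  refine ⟨?_, ?_, fun z hz => ?_⟩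
  · rw [degree_C_mul hK, degree_eq_natDegree hmon.ne_zero]
    simp
  · exact (Splits.C K).mul (Splits.prod fun a _ => Splits.X_sub_C a)
  · rw [← count_roots, hroots]
    refine Multiset.count_eq_one_of_mem S.nodup ?_
    rw [← hroots]
    exact (mem_roots hne).mpr hz

/-! ### Roots and constant roots of the modified Gegenbauer polynomial -/

theorem sq_mem_Ioc_of_mem_Icc {x : ℝ} (hx : x ∈ Set.Icc (-1 : ℝ) 1) (hx0 : x ≠ 0) :
    x ^ 2 ∈ Set.Ioc (0 : ℝ) 1 :=
  ⟨by positivity, by nlinarith [hx.1, hx.2]⟩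

theorem exists_modGegenbauerParam_eq_prod (m e : ℕ) (he : e < 2) {x : ℝ}
    (hx : x ∈ Set.Icc (-1 : ℝ) 1) (hx0 : x ≠ 0) :
    ∃ K : ℝ, K ≠ 0 ∧ ∃ S : Finset ℝ, S.card = 2 * m + e ∧
      modGegenbauerParam (2 * m + e) x = C K * ∏ a ∈ S, (X - C a) := by
  have hc : (0 : ℝ) < 1 / 2 + e := by positivity
  have hy := sq_mem_Ioc_of_mem_Icc hx hx0
  set r := hypRoot m (1 / 2 + (e : ℝ)) (x ^ 2) with hr
  set κ : ℝ := (-1) ^ m * x ^ e / (m.factorial * 4 ^ m)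
  set L : ℝ := (x ^ 2) ^ m / (ascPochhammer ℝ m).eval (1 / 2 + (e : ℝ))
  have hκ : κ ≠ 0 := div_ne_zero
    (mul_ne_zero (pow_ne_zero _ (by norm_num)) (pow_ne_zero _ hx0)) (by positivity)
  have hL : L ≠ 0 := (div_pos (pow_pos hy.1 _) (ascPochhammer_pos m _ hc)).ne'
  have inj1 : Set.InjOn (fun i => r i - ((m + e : ℕ) : ℝ)) (Finset.range m) := by
    intro i hi j hj hij
    exact (hypRoot_strictMonoOn m hc hy).injOn (by simpa using hi) (by simpa using hj)
      (sub_left_inj.mp hij)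
  have inj2 : Set.InjOn (fun i : ℕ => -(1 / 2 + (i : ℝ))) (Finset.Ico m (2 * m + e)) := by
    intro i _ j _ hij
    simpa using hij
  -- The first family is at least `1/2 - m`, the second at most `-1/2 - m`.
  have hdisj : Disjoint ((Finset.range m).image fun i => r i - ((m + e : ℕ) : ℝ))
      ((Finset.Ico m (2 * m + e)).image fun i : ℕ => -(1 / 2 + (i : ℝ))) := by
    refine Finset.disjoint_left.mpr fun z hz1 hz2 => ?_
    obtain ⟨i, hi, rfl⟩ := Finset.mem_image.mp hz1
    obtain ⟨j, hj, hij⟩ := Finset.mem_image.mp hz2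
    have h1 := hypRoot_lower m hc hy (Finset.mem_range.mp hi)
    have h2 : (m : ℝ) ≤ j := by exact_mod_cast (Finset.mem_Ico.mp hj).1
    have h3 : (0 : ℝ) ≤ i := i.cast_nonneg
    push_cast at hij
    linarith
  refine ⟨κ * L * (-1) ^ m, mul_ne_zero (mul_ne_zero hκ hL) (pow_ne_zero _ (by norm_num)),
    (Finset.range m).image (fun i => r i - ((m + e : ℕ) : ℝ)) ∪
      (Finset.Ico m (2 * m + e)).image fun i : ℕ => -(1 / 2 + (i : ℝ)), ?_, ?_⟩
  · rw [Finset.card_union_of_disjoint hdisj, Finset.card_image_of_injOn inj1,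
      Finset.card_image_of_injOn inj2]
    simp
    omega
  · rw [Finset.prod_union hdisj, Finset.prod_image inj1, Finset.prod_image inj2,
      modGegenbauerParam_eq_hypPoly m e he]
    refine Polynomial.funext fun z => ?_
    simp only [eval_mul, eval_C, eval_comp, eval_prod, eval_add, eval_sub, eval_X]
    rw [eval_hypPoly_eq m hc hy]
    have e1 : ∏ i ∈ Finset.range m, (r i - (z + ((m + e : ℕ) : ℝ))) =
        (-1) ^ m * ∏ i ∈ Finset.range m, (z - (r i - ((m + e : ℕ) : ℝ))) := by
      have : ((-1 : ℝ) ^ m) = ∏ i ∈ Finset.range m, (-1 : ℝ) := by simp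
      rw [this, ← Finset.prod_mul_distrib]
      exact Finset.prod_congr rfl fun i _ => by ring
    rw [e1]
    simp only [sub_neg_eq_add]
    ring

theorem exists_modGegenbauerParam_zero_eq_prod (m : ℕ) :
    ∃ K : ℝ, K ≠ 0 ∧ ∃ S : Finset ℝ,
      modGegenbauerParam (2 * m) 0 = C K * ∏ a ∈ S, (X - C a) := by
  have h := modGegenbauerParam_eq_hypPoly m 0 two_pos 0
  refine ⟨(-1) ^ m / (m.factorial * 4 ^ m),
    div_ne_zero (pow_ne_zero _ (by norm_num)) (by positivity),
    (Finset.Ico m (2 * m)).image fun i : ℕ => -(1 / 2 + (i : ℝ)), ?_⟩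
  rw [Finset.prod_image (fun i _ j _ hij => by simpa using hij)]
  rw [zero_pow two_ne_zero, hypPoly_zero_right, one_comp, one_mul, pow_zero, mul_one, add_zero] at h
  rw [h]
  simp only [C_neg, sub_neg_eq_add]

theorem mem_modGegenbauerConstRoots_iff (m e : ℕ) (he : e < 2) (z : ℝ) :
    z ∈ modGegenbauerConstRoots (2 * m + e) ↔
      (∏ i ∈ Finset.Ico m (2 * m + e), (X + C (1 / 2 + (i : ℝ)))).eval z = 0 := by
  constructor
  · intro hz
    -- Near `x = 0` the hypergeometric factor is close to `1`, hence nonzero at `z`.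
    have h1 : ∀ᶠ x in nhds (0 : ℝ),
        (hypPoly m (1 / 2 + (e : ℝ)) (x ^ 2)).eval (z + ((m + e : ℕ) : ℝ)) ≠ 0 := by
      have hcont : Continuous fun x : ℝ =>
          (hypPoly m (1 / 2 + (e : ℝ)) (x ^ 2)).eval (z + ((m + e : ℕ) : ℝ)) :=
        (continuous_hypPoly m _).comp ((continuous_pow 2).prodMk continuous_const)
      refine hcont.continuousAt.eventually_ne ?_
      simp [hypPoly_zero_right]
    obtain ⟨x, hx, hx0⟩ := ((h1.filter_mono nhdsWithin_le_nhds).and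
      (self_mem_nhdsWithin : ∀ᶠ x in nhdsWithin (0 : ℝ) (Set.Ioi 0), 0 < x)).exists
    have h2 := hz x
    rw [IsRoot.def, modGegenbauerParam_eq_hypPoly m e he, eval_mul, eval_mul, eval_C] at h2
    refine (mul_eq_zero.mp ((mul_eq_zero.mp h2).resolve_left ?_)).resolve_left ?_
    · exact div_ne_zero
        (mul_ne_zero (pow_ne_zero _ (by norm_num)) (pow_ne_zero _ hx0.ne')) (by positivity)
    · simpa [eval_comp] using hx
  · intro hz x
    rw [IsRoot.def, modGegenbauerParam_eq_hypPoly m e he, eval_mul, eval_mul, hz, mul_zero,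
      mul_zero]

theorem mem_modGegenbauerNonconstRoots_iff (m e : ℕ) (he : e < 2) {x : ℝ}
    (hx : x ∈ Set.Icc (-1 : ℝ) 1) (hx0 : x ≠ 0) (z : ℝ) :
    z ∈ modGegenbauerNonconstRoots (2 * m + e) x ↔
      ∃ i < m, hypRoot m (1 / 2 + (e : ℝ)) (x ^ 2) i - ((m + e : ℕ) : ℝ) = z := by
  have hc : (0 : ℝ) < 1 / 2 + e := by positivity
  have hy := sq_mem_Ioc_of_mem_Icc hx hx0
  have hκ : (-1) ^ m * x ^ e / (m.factorial * 4 ^ m) ≠ 0 := div_ne_zero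
    (mul_ne_zero (pow_ne_zero _ (by norm_num)) (pow_ne_zero _ hx0)) (by positivity)
  have hroot := eval_hypPoly_eq_zero_iff m hc hy (z + ((m + e : ℕ) : ℝ))
  have hev : (X + C ((m + e : ℕ) : ℝ)).eval z = z + ((m + e : ℕ) : ℝ) := by simp
  simp only [sub_eq_iff_eq_add, ← hroot]
  rw [modGegenbauerNonconstRoots, Set.mem_ofPred_eq, mem_modGegenbauerConstRoots_iff m e he,
    IsRoot.def, modGegenbauerParam_eq_hypPoly m e he, eval_mul, eval_mul, eval_C, eval_comp, hev]
  constructor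
  · rintro ⟨h1, h2⟩
    exact (mul_eq_zero.mp ((mul_eq_zero.mp h1).resolve_left hκ)).resolve_right h2
  · intro h
    refine ⟨by rw [h, zero_mul, mul_zero], fun h0 => ?_⟩
    obtain ⟨i, hi, hiz⟩ := hroot.mp h
    rw [eval_prod, Finset.prod_eq_zero_iff] at h0
    obtain ⟨j, hj, hjz⟩ := h0
    have h1 := hypRoot_lower m hc hy hi
    have h2 : (m : ℝ) ≤ j := by exact_mod_cast (Finset.mem_Ico.mp hj).1
    have h3 : (0 : ℝ) ≤ i := i.cast_nonneg
    simp only [eval_add, eval_X, eval_C] at hjz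
    push_cast at hiz
    linarith

theorem mainTheorem2 (n : ℕ) :
    (∀ x ∈ Set.Icc (-1 : ℝ) 1, x ≠ 0 →
      (modGegenbauerParam n x).degree = (n : WithBot ℕ) ∧
      (modGegenbauerParam n x).Splits ∧
      ∀ z : ℝ, (modGegenbauerParam n x).IsRoot z →
        (modGegenbauerParam n x).rootMultiplicity z = 1) ∧
    (Even n →
      modGegenbauerParam n 0 ≠ 0 ∧
      (modGegenbauerParam n 0).Splits ∧
      ∀ z : ℝ, (modGegenbauerParam n 0).IsRoot z →
        (modGegenbauerParam n 0).rootMultiplicity z = 1) ∧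
    ∃ γ : Fin (n / 2) → ℝ → ℝ,
      (∀ x ∈ Set.Icc (-1 : ℝ) 1, x ≠ 0 →
        StrictAnti (fun i => γ i x) ∧
        modGegenbauerNonconstRoots n x = Set.range (fun i => γ i x)) ∧
      ∀ i, StrictMonoOn (γ i) (Set.Ico (-1) 0) ∧
        StrictAntiOn (γ i) (Set.Ioc 0 1) ∧
        Filter.Tendsto (γ i) (nhdsWithin 0 {0}ᶜ) Filter.atTop := by
  obtain ⟨m, e, he, rfl⟩ : ∃ m e, e < 2 ∧ n = 2 * m + e :=
    ⟨n / 2, n % 2, Nat.mod_lt _ two_pos, (Nat.div_add_mod n 2).symm⟩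
  have hdiv : (2 * m + e) / 2 = m := by omega
  have hc : (0 : ℝ) < 1 / 2 + e := by positivity
  refine ⟨fun x hx hx0 => ?_, fun heven => ?_, ?_⟩
  · obtain ⟨K, hK, S, hS, h⟩ := exists_modGegenbauerParam_eq_prod m e he hx hx0
    rw [h, ← hS]
    exact degree_splits_simple_of_eq_prod hK S
  · obtain rfl : e = 0 := by
      obtain ⟨k, hk⟩ := heven
      omega
    obtain ⟨K, hK, S, h⟩ := exists_modGegenbauerParam_zero_eq_prod m
    rw [add_zero, h]
    exact ⟨mul_ne_zero (C_ne_zero.mpr hK) (monic_prod_X_sub_C _ _).ne_zero,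
      (degree_splits_simple_of_eq_prod hK S).2⟩
  · rw [hdiv]
    -- `hypRoot` lists the roots in increasing order, so the index is reversed.
    refine ⟨fun i x => hypRoot m (1 / 2 + (e : ℝ)) (x ^ 2) (i.rev : ℕ) - ((m + e : ℕ) : ℝ),
      fun x hx hx0 => ⟨fun i j hij => ?_, Set.ext fun z => ?_⟩, fun i => ⟨?_, ?_, ?_⟩⟩
    · exact sub_lt_sub_right (hypRoot_strictMonoOn m hc (sq_mem_Ioc_of_mem_Icc hx hx0)
        j.rev.2 i.rev.2 (Fin.rev_lt_rev.mpr hij)) _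
    · rw [mem_modGegenbauerNonconstRoots_iff m e he hx hx0]
      constructor
      · rintro ⟨i, hi, rfl⟩
        exact ⟨Fin.rev ⟨i, hi⟩, by simp only [Fin.rev_rev]⟩
      · rintro ⟨i, rfl⟩
        exact ⟨_, i.rev.2, rfl⟩
    · intro a ha b hb hab
      refine sub_lt_sub_right (strictAntiOn_hypRoot i.rev.2 hc
        (sq_mem_Ioc_of_mem_Icc ⟨hb.1, by linarith [hb.2]⟩ hb.2.ne)
        (sq_mem_Ioc_of_mem_Icc ⟨ha.1, by linarith [ha.2]⟩ ha.2.ne) ?_) _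
      nlinarith [hb.2]
    · intro a ha b hb hab
      refine sub_lt_sub_right (strictAntiOn_hypRoot i.rev.2 hc
        (sq_mem_Ioc_of_mem_Icc ⟨by linarith [ha.1], ha.2⟩ ha.1.ne')
        (sq_mem_Ioc_of_mem_Icc ⟨by linarith [hb.1], hb.2⟩ hb.1.ne') ?_) _
      nlinarith [ha.1]
    · have hsq : Filter.Tendsto (fun x : ℝ => x ^ 2) (nhdsWithin 0 {0}ᶜ)
          (nhdsWithin 0 (Set.Ioi 0)) := by
        refine tendsto_nhdsWithin_iff.mpr ⟨?_, ?_⟩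
        · have h := (continuous_pow 2 : Continuous fun x : ℝ => x ^ 2).tendsto 0
          rw [zero_pow two_ne_zero] at h
          exact h.mono_left nhdsWithin_le_nhds
        · filter_upwards [self_mem_nhdsWithin] with x hx
          exact sq_pos_of_ne_zero hx
      exact Filter.tendsto_atTop_add_const_right _ _
        ((tendsto_hypRoot_atTop i.rev.2 hc).comp hsq)
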